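/- Let $X\subset\mathbb C$ be a nonempty compact set and let $f\colon X\to X$ be a continuous map which extends to a holomorphic map $f\colon W'\to W$ between open neighborhoods $W',W\subset\mathbb C$ of $X$, such that $f^{-1}(X)=\{z\in W': f(z)\in X\}=X$ and $\deg f|_X=N\ge 2$, i.e. every $x\in X$ has exactly $N$ preimages in $W'$ counted with multiplicity. Let $h_{top}(f)$ denote the topological entropy of $f\colon X\to X$. (1) If $X$ is not equal to the union of the cycles of $f\colon X\to X$ that contain a critical point (a point where $f'=0$), then $h_{top}(f)\ge\log N$. (2) If, additionally, $f\colon W'\to W$ is a proper map of degree $N$ (so that every $w\in W$ has exactly $N$ preimages in $W'$ counted with multiplicity), $W$ is (connected and) simply connected, and $W'$ has finitely many connected components, each of them simply connected, then (without the assumption on $X$ made in (1)) $h_{top}(f)\ge\log N$, unless $W'$ is connected and simply connected and $X=\{c\}$ for a fixed critical point $c$ of $f$ of multiplicity $N$ (i.e. $f(c)=c$ and $f(z)-c$ vanishes to order exactly $N$ at $c$). -/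

import Mathlib

/-- The map `g : W' → ℂ` has degree `N` over the set `Y`: every point of `Y` has finitely many
preimages in `W'`, and exactly `N` of them when each preimage is counted with its multiplicity
(the order of vanishing of `w ↦ g w - y` at that preimage). -/
def HasDegreeOver (g : ℂ → ℂ) (W' Y : Set ℂ) (N : ℕ) : Prop :=
  ∀ y ∈ Y, {z ∈ W' | g z = y}.Finite ∧
    ∑ᶠ z ∈ {z ∈ W' | g z = y}, analyticOrderNatAt (fun w => g w - y) z = N

/-- The union of the cycles of `f : X → X` that contain a critical point of `g`, where
`g` is a holomorphic extension of `f` to a neighbourhood of `X`. -/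
def unionOfCriticalCycles {X : Set ℂ} (f : X → X) (g : ℂ → ℂ) : Set X :=
  {x | ∃ c : X, deriv g (c : ℂ) = 0 ∧ c ∈ Function.periodicPts f ∧ ∃ k : ℕ, f^[k] c = x}

/-- `W'` has finitely many connected components and each of them is simply connected. -/
def HasFinitelyManySimplyConnectedComponents (W' : Set ℂ) : Prop :=
  {U : Set ℂ | ∃ z ∈ W', U = connectedComponentIn W' z}.Finite ∧
    ∀ z ∈ W', IsSimplyConnected (connectedComponentIn W' z)

/-!
Away from the critical points, every point of `X` has `N` preimages in `X`, uniformly separated.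
Counting preimages of order `n` of a point `x` therefore yields `N ^ (n * (1 - ε))` separated
orbits, provided backward orbits of `x` pass near the critical points with frequency at most `ε`.
Passages near a nonperiodic point are rare, because its return times to small neighbourhoods are
long; a critical cycle attracts, so a backward orbit of a point `x` off the cycle cannot come
close to it except within a bounded time before reaching `x`.

If instead `X` is a union of critical cycles, then `f` is bijective and `g` is totally ramified at
every point of `X`. Every component of `W'` maps onto `W`, so the one-point fibres force `W'` to be
connected. For a point `a` of `X`, an `N`-th root `φ` of `g - g a` exists on the simply connected
set `W'`, and it maps `W'` onto the preimage of `W` under `s ↦ s ^ N + g a`. At a second totally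
ramified point `b`, the `N` distinct values `ζ * φ b` with `ζ ^ N = 1` would all have to be attained
at `b`, so `X` is a single point.
-/

open Filter Topology Uniformity Dynamics

section BackwardVisits

variable {X : Type*} {f : X → X} {U V : Set X} {x c : X} {ε ε₁ ε₂ : ℝ} {n : ℕ}

open Classical in
/-- The number of visits of `z, f z, …, f^[n - 1] z` to `U`. -/
noncomputable def visitCount (f : X → X) (U : Set X) (n : ℕ) (z : X) : ℕ :=
  Nat.count (fun k => f^[k] z ∈ U) n

/-- The backward orbits of `x` visit `U` with frequency at most `ε`: an orbit of length `n` that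
ends in `x` meets `U` at most `ε * n + O(1)` times, uniformly in `n` and in the orbit. -/
def BackwardVisitFrequencyLE (f : X → X) (U : Set X) (x : X) (ε : ℝ) : Prop :=
  ∃ C : ℝ, ∀ n z, f^[n] z = x → (visitCount f U n z : ℝ) ≤ ε * n + C

lemma visitCount_le_succ (f : X → X) (U : Set X) (n : ℕ) (z : X) :
    visitCount f U n z ≤ visitCount f U (n + 1) z := by
  classical exact Nat.count_monotone _ n.le_succ

lemma visitCount_succ_of_mem {z : X} (h : f^[n] z ∈ U) :
    visitCount f U (n + 1) z = visitCount f U n z + 1 := by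
  rw [visitCount, Nat.count_succ, if_pos h, visitCount]

lemma visitCount_union_le (f : X → X) (U V : Set X) (n : ℕ) (z : X) :
    visitCount f (U ∪ V) n z ≤ visitCount f U n z + visitCount f V n z := by
  classical
  simp only [visitCount, Nat.count_eq_card_filter_range, Set.mem_union, Finset.filter_or]
  exact Finset.card_union_le _ _

lemma BackwardVisitFrequencyLE.mono (h : BackwardVisitFrequencyLE f U x ε₁) (hε : ε₁ ≤ ε₂) :
    BackwardVisitFrequencyLE f U x ε₂ := by
  obtain ⟨C, hC⟩ := h
  exact ⟨C, fun n z hz => (hC n z hz).trans (by gcongr)⟩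

lemma BackwardVisitFrequencyLE.union (hU : BackwardVisitFrequencyLE f U x ε₁)
    (hV : BackwardVisitFrequencyLE f V x ε₂) :
    BackwardVisitFrequencyLE f (U ∪ V) x (ε₁ + ε₂) := by
  obtain ⟨C, hC⟩ := hU
  obtain ⟨D, hD⟩ := hV
  refine ⟨C + D, fun n z hz => ?_⟩
  calc (visitCount f (U ∪ V) n z : ℝ) ≤ visitCount f U n z + visitCount f V n z :=
        mod_cast visitCount_union_le f U V n z
    _ ≤ (ε₁ + ε₂) * n + (C + D) := by linarith [hC n z hz, hD n z hz]

lemma count_le_div_add_one {p : ℕ → Prop} [DecidablePred p] {T : ℕ} (hT : 0 < T)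
    (hp : ∀ k l, p k → p l → k < l → k + T ≤ l) (n : ℕ) : Nat.count p n ≤ n / T + 1 := by
  rw [Nat.count_eq_card_filter_range, ← Finset.card_range (n / T + 1)]
  refine Finset.card_le_card_of_injOn (· / T) (fun k hk => ?_) fun k hk l hl hkl => ?_
  · have hkn : k < n := Finset.mem_range.mp (Finset.mem_filter.mp hk).1
    exact Finset.mem_coe.mpr (Finset.mem_range_succ_iff.mpr (Nat.div_le_div_right hkn.le))
  · have notLt {k l : ℕ} (hk : p k) (hl : p l) (hkl : k / T = l / T) : ¬ k < l := fun hlt => by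
      have hdiv : (k + T) / T ≤ l / T := Nat.div_le_div_right (hp k l hk hl hlt)
      rw [Nat.add_div_right k hT] at hdiv
      omega
    have hpk : p k := (Finset.mem_filter.mp hk).2
    have hpl : p l := (Finset.mem_filter.mp hl).2
    exact le_antisymm (not_lt.mp (notLt hpl hpk hkl.symm)) (not_lt.mp (notLt hpk hpl hkl))

lemma exists_nhds_iterate_notMem_of_not_periodic [TopologicalSpace X] [T2Space X]
    (hf : Continuous f) (hc : c ∉ Function.periodicPts f) (T : ℕ) :
    ∃ U ∈ 𝓝 c, ∀ k, 0 < k → k < T → ∀ z ∈ U, f^[k] z ∉ U := by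
  suffices h : ∀ᶠ U in (𝓝 c).smallSets, ∀ k ∈ Finset.Ioo 0 T, ∀ z ∈ U, f^[k] z ∉ U by
    obtain ⟨U, hU, h⟩ := eventually_smallSets.mp h
    exact ⟨U, hU, fun k hk hkT => h U le_rfl k (Finset.mem_Ioo.mpr ⟨hk, hkT⟩)⟩
  refine (eventually_all_finset _).mpr fun k hk => eventually_smallSets.mpr ?_
  have hne : c ≠ f^[k] c := fun h => hc ⟨k, (Finset.mem_Ioo.mp hk).1, h.symm⟩
  obtain ⟨A, hA, B, hB, hAB⟩ := Filter.disjoint_iff.mp (disjoint_nhds_nhds.mpr hne)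
  exact ⟨A ∩ f^[k] ⁻¹' B, inter_mem hA ((hf.iterate k).continuousAt hB), fun U hU z hz hz' =>
    Set.disjoint_left.mp hAB (hU hz').1 (hU hz).2⟩

lemma exists_nhds_backwardVisitFrequencyLE_of_not_periodic [TopologicalSpace X] [T2Space X]
    (hf : Continuous f) (hc : c ∉ Function.periodicPts f) (x : X) (hε : 0 < ε) :
    ∃ U ∈ 𝓝 c, BackwardVisitFrequencyLE f U x ε := by
  obtain ⟨T, hT⟩ := exists_nat_one_div_lt hε
  obtain ⟨U, hU, hreturn⟩ := exists_nhds_iterate_notMem_of_not_periodic hf hc (T + 1)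
  refine ⟨U, hU, 1, fun n z _ => ?_⟩
  have hcount : visitCount f U n z ≤ n / (T + 1) + 1 := by
    classical
    refine count_le_div_add_one T.succ_pos (fun k l hk hl hkl => ?_) n
    by_contra! hlt
    refine hreturn (l - k) (by omega) (by omega) (f^[k] z) hk ?_
    rwa [← Function.iterate_add_apply, Nat.sub_add_cancel hkl.le]
  calc (visitCount f U n z : ℝ) ≤ ((n / (T + 1) : ℕ) : ℝ) + 1 := mod_cast hcount
    _ ≤ n / ((T + 1 : ℕ) : ℝ) + 1 := by gcongr; exact Nat.cast_div_le
    _ = 1 / (T + 1) * n + 1 := by push_cast; ring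
    _ ≤ ε * n + 1 := by gcongr

lemma tendsto_iterate_of_dist_le_mul [PseudoMetricSpace X] {K : ℝ} (hK₀ : 0 ≤ K) (hK₁ : K < 1)
    (h : ∀ᶠ z in 𝓝 c, dist (f z) c ≤ K * dist z c) :
    Tendsto (fun q : ℕ × X => f^[q.1] q.2) (atTop ×ˢ 𝓝 c) (𝓝 c) := by
  obtain ⟨r, hr, hball⟩ := Metric.eventually_nhds_iff_ball.mp h
  have hcontr : ∀ n, ∀ z ∈ Metric.ball c r, dist (f^[n] z) c ≤ K ^ n * dist z c := by
    intro n z hz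
    induction n with
    | zero => simp
    | succ n ih =>
      have hmem : dist (f^[n] z) c < r :=
        (ih.trans (mul_le_of_le_one_left dist_nonneg (pow_le_one₀ hK₀ hK₁.le))).trans_lt hz
      calc dist (f^[n + 1] z) c = dist (f (f^[n] z)) c := by rw [Function.iterate_succ_apply']
        _ ≤ K * dist (f^[n] z) c := hball _ hmem
        _ ≤ K * (K ^ n * dist z c) := by gcongr
        _ = K ^ (n + 1) * dist z c := by ring
  have hlim : Tendsto (fun q : ℕ × X => K ^ q.1 * r) (atTop ×ˢ 𝓝 c) (𝓝 0) := by
    simpa using ((tendsto_pow_atTop_nhds_zero_of_lt_one hK₀ hK₁).comp tendsto_fst).mul_const r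
  refine tendsto_iff_dist_tendsto_zero.mpr (squeeze_zero' (.of_forall fun _ => dist_nonneg) ?_ hlim)
  filter_upwards [tendsto_snd.eventually (Metric.ball_mem_nhds c hr)] with q hq
  exact (hcontr q.1 q.2 hq).trans (by gcongr)

lemma eventually_iterate_ne_of_tendsto [TopologicalSpace X] [T1Space X] (hf : Continuous f)
    {p : ℕ} (hp : 0 < p)
    (h : Tendsto (fun q : ℕ × X => (f^[p])^[q.1] q.2) (atTop ×ˢ 𝓝 c) (𝓝 c))
    (hx : ∀ k, f^[k] c ≠ x) : ∀ᶠ q : ℕ × X in atTop ×ˢ 𝓝 c, f^[q.1] q.2 ≠ x := by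
  have hne : ∀ᶠ w in 𝓝 c, ∀ j ∈ Finset.range p, f^[j] w ≠ x :=
    (eventually_all_finset _).mpr fun j _ => (hf.iterate j).continuousAt.eventually_ne (hx j)
  have hdiv : Tendsto (Prod.map (· / p) id) (atTop ×ˢ 𝓝 c) (atTop ×ˢ 𝓝 c) :=
    (Nat.tendsto_div_const_atTop hp.ne').prodMap tendsto_id
  filter_upwards [(h.comp hdiv).eventually hne] with ⟨n, z⟩ hnz
  have := hnz (n % p) (Finset.mem_range.mpr (Nat.mod_lt n hp))
  simpa only [Function.comp_apply, Prod.map_apply, id, ← Function.iterate_mul,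
    ← Function.iterate_add_apply, Nat.mod_add_div] using this

lemma exists_nhds_backwardVisitFrequencyLE_zero [TopologicalSpace X]
    (h : ∀ᶠ q : ℕ × X in atTop ×ˢ 𝓝 c, f^[q.1] q.2 ≠ x) :
    ∃ U ∈ 𝓝 c, BackwardVisitFrequencyLE f U x 0 := by
  classical
  obtain ⟨P, hP, Q, hQ, hPQ⟩ := eventually_prod_iff.mp h
  obtain ⟨M, hM⟩ := eventually_atTop.mp hP
  refine ⟨{z | Q z}, hQ, M, fun n z hz => ?_⟩
  have hvisits : {k ∈ Finset.range n | f^[k] z ∈ {z | Q z}} ⊆ Finset.Ico (n - M) n := by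
    intro k hk
    obtain ⟨hkn, hkQ⟩ := Finset.mem_filter.mp hk
    rw [Finset.mem_range] at hkn
    rw [Finset.mem_Ico]
    refine ⟨?_, hkn⟩
    by_contra! hlt
    refine hPQ (hM (n - k) (by omega)) hkQ ?_
    rwa [← Function.iterate_add_apply, Nat.sub_add_cancel hkn.le]
  have hcard := Finset.card_le_card hvisits
  rw [Nat.card_Ico, ← Nat.count_eq_card_filter_range] at hcard
  rw [zero_mul, zero_add, visitCount]
  exact_mod_cast (show Nat.count (fun k => f^[k] z ∈ {z | Q z}) n ≤ M by omega)

lemma exists_nhdsSet_backwardVisitFrequencyLE [TopologicalSpace X] [T2Space X] (hf : Continuous f)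
    {K : Set X} (hK : K.Finite)
    (h : ∀ c ∈ K, c ∈ Function.periodicPts f → ∀ᶠ q : ℕ × X in atTop ×ˢ 𝓝 c, f^[q.1] q.2 ≠ x)
    (hε : 0 < ε) : ∃ U ∈ 𝓝ˢ K, BackwardVisitFrequencyLE f U x ε := by
  induction K, hK using Set.Finite.induction_on generalizing ε with
  | empty =>
    refine ⟨∅, by simp, 0, fun n z _ => ?_⟩
    simp only [visitCount, Set.mem_empty_iff_false, Nat.count_false, Nat.cast_zero, add_zero]
    positivity
  | @insert c K _ _ ih =>
    obtain ⟨V, hV, hVx⟩ := ih (fun c hc => h c (Set.mem_insert_of_mem _ hc)) (half_pos hε)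
    obtain ⟨U, hU, hUx⟩ : ∃ U ∈ 𝓝 c, BackwardVisitFrequencyLE f U x (ε / 2) := by
      by_cases hper : c ∈ Function.periodicPts f
      · obtain ⟨U, hU, hUx⟩ :=
          exists_nhds_backwardVisitFrequencyLE_zero (h c (Set.mem_insert _ _) hper)
        exact ⟨U, hU, hUx.mono (half_pos hε).le⟩
      · exact exists_nhds_backwardVisitFrequencyLE_of_not_periodic hf hper x (half_pos hε)
    refine ⟨U ∪ V, ?_, add_halves ε ▸ hUx.union hVx⟩
    rw [nhdsSet_insert]
    exact union_mem_sup hU hV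

end BackwardVisits

section SeparatedPreimages

variable {X : Type*} {f : X → X} {V : SetRel X X} {M N n : ℕ} {w x : X}

/-- The fibre of `f` over `x` contains `N` pairwise `V`-separated points. -/
def HasSeparatedPreimages (f : X → X) (V : SetRel X X) (N : ℕ) (x : X) : Prop :=
  ∃ s : Finset X, N ≤ s.card ∧ (∀ z ∈ s, f z = x) ∧ V.IsSeparated (s : Set X)

lemma HasSeparatedPreimages.mono (h : HasSeparatedPreimages f V N x) (hMN : M ≤ N) :
    HasSeparatedPreimages f V M x := by
  obtain ⟨s, hs⟩ := h
  exact ⟨s, hMN.trans hs.1, hs.2⟩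

lemma HasSeparatedPreimages.iterate_succ
    (h : HasSeparatedPreimages f^[n] (dynEntourage f V n) N w) :
    HasSeparatedPreimages f^[n + 1] (dynEntourage f V (n + 1)) N (f w) := by
  obtain ⟨s, hcard, hs, hsep⟩ := h
  exact ⟨s, hcard, fun z hz => by rw [Function.iterate_succ_apply', hs z hz],
    hsep.mono_left (dynEntourage_antitone f V n.le_succ)⟩

lemma HasSeparatedPreimages.iterate_succ_mul (h : HasSeparatedPreimages f V N x)
    (hM : ∀ w, f w = x → HasSeparatedPreimages f^[n] (dynEntourage f V n) M w) :
    HasSeparatedPreimages f^[n + 1] (dynEntourage f V (n + 1)) (N * M) x := by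
  classical
  obtain ⟨s, hcard, hs, hsep⟩ := h
  choose! S hScard hS hSsep using fun w hw => hM w (hs w hw)
  refine ⟨s.biUnion S, ?_, fun z hz => ?_, fun z hz z' hz' hne => ?_⟩
  · rw [Finset.card_biUnion fun w hw w' hw' hww => Finset.disjoint_left.mpr fun z hz hz' =>
      hww ((hS w hw z hz).symm.trans (hS w' hw' z hz'))]
    exact (Nat.mul_le_mul_right M hcard).trans (Finset.card_nsmul_le_sum s _ M hScard)
  · obtain ⟨w, hw, hzw⟩ := Finset.mem_biUnion.mp hz
    rw [Function.iterate_succ_apply', hS w hw z hzw, hs w hw]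
  · obtain ⟨w, hw, hzw⟩ := Finset.mem_biUnion.mp (Finset.mem_coe.mp hz)
    obtain ⟨w', hw', hzw'⟩ := Finset.mem_biUnion.mp (Finset.mem_coe.mp hz')
    intro hzz'
    rcases eq_or_ne w w' with rfl | hww
    · exact hSsep w hw hzw hzw' hne (dynEntourage_antitone f V n.le_succ hzz')
    · have hlast := mem_dynEntourage.mp hzz' n n.lt_succ_self
      rw [hS w hw z hzw, hS w' hw' z' hzw'] at hlast
      exact hsep hw hw' hww hlast

lemma hasSeparatedPreimages_iterate (hN : N ≠ 0) (U : Set X)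
    (hbranch : ∀ y, (∃ w ∈ U, f w = y) ∨ HasSeparatedPreimages f V N y) (n b : ℕ) (x : X)
    (hb : ∀ z, f^[n] z = x → visitCount f U n z ≤ b) :
    HasSeparatedPreimages f^[n] (dynEntourage f V n) (N ^ (n - b)) x := by
  induction n generalizing b x with
  | zero => exact ⟨{x}, by simp, by simp, by simp⟩
  | succ n ih =>
    rcases hbranch x with ⟨w, hwU, rfl⟩ | hx
    · have hvisit : ∀ z, f^[n] z = w → visitCount f U n z + 1 ≤ b := fun z hz => by
        rw [← visitCount_succ_of_mem (hz ▸ hwU)]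
        exact hb z (by rw [Function.iterate_succ_apply', hz])
      have hsep := ih (b - 1) w fun z hz => Nat.le_sub_one_of_lt (hvisit z hz)
      have hb₀ : 0 < b := by
        obtain ⟨s, hcard, hs, -⟩ := hsep
        obtain ⟨z, hz⟩ := Finset.card_pos.mp ((Nat.pow_pos hN.bot_lt).trans_le hcard)
        exact (Nat.succ_pos _).trans_le (hvisit z (hs z hz))
      exact hsep.iterate_succ.mono (Nat.pow_le_pow_right hN.bot_lt (by omega))
    · have hpow : N ^ (n + 1 - b) ≤ N * N ^ (n - b) := by
        rw [← pow_succ']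
        exact Nat.pow_le_pow_right hN.bot_lt (by omega)
      refine (hx.iterate_succ_mul fun w hw => ih b w fun z hz => ?_).mono hpow
      exact (visitCount_le_succ f U n z).trans
        (hb z (by rw [Function.iterate_succ_apply', hz, hw]))

end SeparatedPreimages

section EntropyLowerBound

variable {X : Type*} [UniformSpace X] {f : X → X}

lemma le_coverEntropy_of_frequently_isSeparated {F : Set X} {V : SetRel X X} (hV : V ∈ 𝓤 X)
    {a : ℝ} (h : ∃ᶠ n : ℕ in atTop, ∃ S : Finset X, (S : Set X) ⊆ F ∧
      (dynEntourage f V n).IsSeparated (S : Set X) ∧ Real.exp (a * n) ≤ S.card) :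
    (a : EReal) ≤ coverEntropy f F := by
  obtain ⟨D, hD, hDsymm, hDV⟩ := comp_symm_mem_uniformity_sets hV
  refine le_trans (Frequently.le_expGrowthSup (h.mono ?_))
    (netEntropyEntourage_le_coverEntropy (T := f) (F := F) hD)
  rintro n ⟨S, hSF, hsep, hcard⟩
  have hnet : IsDynNetIn f F D n (S : Set X) :=
    ⟨hSF, fun z hz z' hz' hne => Set.disjoint_iff_inter_eq_empty.mpr <|
      Set.not_nonempty_iff_eq_empty.mp fun hzz' => hsep hz' hz hne.symm <|
        dynEntourage_monotone f n hDV (mem_ball_dynEntourage_comp f n z z' hzz')⟩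
  calc EReal.exp (a * n) = ENNReal.ofReal (Real.exp (a * n)) := EReal.exp_coe (a * n)
    _ ≤ ENNReal.ofReal S.card := ENNReal.ofReal_le_ofReal hcard
    _ = ((S.card : ℕ∞) : ENNReal) := by simp
    _ ≤ netMaxcard f F D n := ENat.toENNReal_mono hnet.card_le_netMaxcard

theorem log_le_coverEntropy_of_backwardVisitFrequencyLE {N : ℕ} (hN : N ≠ 0) (x : X)
    (h : ∀ ε > 0, ∃ U, BackwardVisitFrequencyLE f U x ε ∧ ∃ V ∈ 𝓤 X, ∀ y,
      (∃ w ∈ U, f w = y) ∨ HasSeparatedPreimages f V N y) :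
    (Real.log N : EReal) ≤ coverEntropy f Set.univ := by
  refine EReal.ge_of_forall_gt_iff_ge.mp fun a ha => ?_
  have ha : 0 < Real.log N - a := sub_pos.mpr (EReal.coe_lt_coe_iff.mp ha)
  obtain ⟨ε, hε, hεa⟩ := exists_pos_mul_lt ha (Real.log N)
  obtain ⟨U, ⟨C, hC⟩, V, hV, hbranch⟩ := h ε hε
  refine le_coverEntropy_of_frequently_isSeparated hV (Eventually.frequently ?_)
  have hlarge : ∀ᶠ n : ℕ in atTop, Real.log N * C ≤ (Real.log N - a - Real.log N * ε) * n :=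
    (tendsto_natCast_atTop_atTop.const_mul_atTop (sub_pos.mpr hεa)).eventually_ge_atTop _
  filter_upwards [hlarge] with n hn
  obtain ⟨S, hcard, -, hsep⟩ := hasSeparatedPreimages_iterate hN U hbranch n ⌊ε * n + C⌋₊ x
    fun z hz => Nat.le_floor (hC n z hz)
  have hexponent : n - (ε * n + C) ≤ (n - ⌊ε * n + C⌋₊ : ℕ) := by
    have hC₀ : 0 ≤ C := by simpa [visitCount] using hC 0 x rfl
    have hfloor := Nat.floor_le (show 0 ≤ ε * n + C by positivity)
    have hsub : (n : ℝ) ≤ (n - ⌊ε * n + C⌋₊ : ℕ) + ⌊ε * n + C⌋₊ := mod_cast le_tsub_add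
    linarith
  refine ⟨S, Set.subset_univ _, hsep, ?_⟩
  calc Real.exp (a * n) ≤ Real.exp (Real.log N * (n - (ε * n + C))) :=
        Real.exp_le_exp.mpr (by linarith)
    _ ≤ Real.exp (Real.log N * (n - ⌊ε * n + C⌋₊ : ℕ)) := by gcongr
    _ = (N : ℝ) ^ (n - ⌊ε * n + C⌋₊) := by
        rw [Real.exp_mul, Real.exp_log (by positivity), Real.rpow_natCast]
    _ ≤ S.card := mod_cast hcard

end EntropyLowerBound

section Topology

variable {A B C : Type*} [TopologicalSpace A] [TopologicalSpace B] [TopologicalSpace C]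

lemma exists_entourage_injOn_ball {X Y : Type*} [UniformSpace X] {f : X → Y} {K : Set X}
    (hK : IsCompact K) (h : ∀ z ∈ K, ∃ U ∈ 𝓝 z, Set.InjOn f U) :
    ∃ V ∈ 𝓤 X, ∀ z ∈ K, Set.InjOn f (UniformSpace.ball z V) := by
  choose U hU hinj using h
  obtain ⟨V, hV, hball⟩ := lebesgue_number_lemma_nhds' hK hU
  refine ⟨V, hV, fun z hz => ?_⟩
  obtain ⟨y, hy⟩ := hball z hz
  exact (hinj y y.2).mono hy

lemma eq_univ_of_isClopen_of_preimage_singleton_subset [PreconnectedSpace C] {p : B → C}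
    (hopen : IsOpenMap p) (hclosed : IsClosedMap p) {S : Set B} (hS : IsClopen S) {y : C}
    (hy : p ⁻¹' {y} ⊆ S) : S = Set.univ := by
  by_contra hne
  have hcompl : IsClopen (p '' Sᶜ) := ⟨hclosed _ hS.compl.isClosed, hopen _ hS.compl.isOpen⟩
  have huniv := hcompl.eq_univ ((Set.nonempty_compl.mpr hne).image p)
  obtain ⟨b, hbS, hby⟩ : y ∈ p '' Sᶜ := huniv ▸ Set.mem_univ y
  exact hbS (hy hby)

lemma surjective_of_isProperMap_comp [T2Space B] [PreconnectedSpace C] {φ : A → B} {p : B → C}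
    (hφ : Continuous φ) (hφopen : IsOpenMap φ) (hp : Continuous p) (hpopen : IsOpenMap p)
    (hpclosed : IsClosedMap p) (hcomp : IsProperMap (p ∘ φ)) {y : C}
    (hy : p ⁻¹' {y} ⊆ Set.range φ) : Function.Surjective φ := by
  have hφproper : IsProperMap φ := isProperMap_of_comp_of_t2 hφ hp hcomp
  exact Set.range_eq_univ.mp <| eq_univ_of_isClopen_of_preimage_singleton_subset hpopen hpclosed
    ⟨hφproper.isClosedMap.isClosed_range, hφopen.isOpen_range⟩ hy

end Topology

section ComplexAnalysis

section NonconstantMaps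

variable {E F : Type*} [NormedAddCommGroup E] [NormedSpace ℂ E] [NormedAddCommGroup F]
  [NormedSpace ℂ F] {W' : Set E}

lemma not_eventually_eq_of_isProperMap [Nontrivial E] {g : E → F} {W : Set F} (hW' : IsOpen W')
    (hg : AnalyticOnNhd ℂ g W') (hmaps : Set.MapsTo g W' W)
    (hprop : IsProperMap (hmaps.restrict g W' W)) {a : E} (ha : a ∈ W') :
    ¬ ∀ᶠ z in 𝓝 a, g z = g a := by
  intro hconst
  have : NoncompactSpace E := NormedSpace.noncompactSpace ℂ E
  have : ConnectedSpace E := inferInstance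
  set D := connectedComponentIn W' a
  have hDconst : Set.EqOn g (fun _ => g a) D :=
    (hg.mono (connectedComponentIn_subset W' a)).eqOn_of_preconnected_of_eventuallyEq
      analyticOnNhd_const isPreconnected_connectedComponentIn (mem_connectedComponentIn ha) hconst
  have hDimage : D = Subtype.val '' connectedComponent (⟨a, ha⟩ : W') :=
    connectedComponentIn_eq_image ha
  have hDcompact : IsCompact D := by
    have hfibre := hprop.isCompact_preimage (isCompact_singleton (x := ⟨g a, hmaps ha⟩))
    have hsub : connectedComponent (⟨a, ha⟩ : W') ⊆
        hmaps.restrict g W' W ⁻¹' {⟨g a, hmaps ha⟩} := fun z hz =>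
      Subtype.ext <| hDconst <| hDimage ▸ Set.mem_image_of_mem _ hz
    rw [hDimage]
    exact (hfibre.of_isClosed_subset isClosed_connectedComponent hsub).image continuous_subtype_val
  have hDuniv : D = Set.univ := IsClopen.eq_univ
    ⟨hDcompact.isClosed, hW'.connectedComponentIn⟩ ⟨a, mem_connectedComponentIn ha⟩
  exact noncompact_univ E (hDuniv ▸ hDcompact)

lemma isOpenMap_restrict_of_not_eventually_eq {g : E → ℂ} {W : Set ℂ} (hW' : IsOpen W')
    (hg : AnalyticOnNhd ℂ g W') (hconst : ∀ a ∈ W', ¬ ∀ᶠ z in 𝓝 a, g z = g a)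
    (hmaps : Set.MapsTo g W' W) : IsOpenMap (hmaps.restrict g W' W) := by
  refine IsOpenMap.subtype_mk (isOpenMap_iff_nhds_le.mpr fun z => ?_) _
  change 𝓝 (g z) ≤ map (g ∘ Subtype.val) (𝓝 z)
  rw [← Filter.map_map, hW'.isOpenEmbedding_subtypeVal.map_nhds_eq]
  exact (hg z z.2).eventually_constant_or_nhds_le_map_nhds.resolve_left (hconst z z.2)

end NonconstantMaps

section CriticalPoints

variable {𝕜 E : Type*} [NontriviallyNormedField 𝕜] [NormedAddCommGroup E] [NormedSpace 𝕜 E]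
  {g : 𝕜 → E} {K : Set 𝕜}

lemma finite_setOf_eq_zero_of_isCompact (hK : IsCompact K) (hg : AnalyticOnNhd 𝕜 g K)
    (h : ∀ a ∈ K, ¬ ∀ᶠ z in 𝓝 a, g z = 0) : {z ∈ K | g z = 0}.Finite := by
  by_contra hinf
  obtain ⟨a, haK, ha⟩ :=
    Set.Infinite.exists_accPt_of_subset_isCompact hinf hK (Set.sep_subset K _)
  have hfreq : ∃ᶠ z in 𝓝[≠] a, g z = 0 :=
    (accPt_iff_frequently_nhdsNE.mp ha).mono fun z hz => hz.2
  exact h a haK ((hg a haK).frequently_zero_iff_eventually_zero.mp hfreq)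

lemma finite_setOf_deriv_eq_zero_of_isCompact [CharZero 𝕜] [CompleteSpace E] (hK : IsCompact K)
    (hg : AnalyticOnNhd 𝕜 g K) (h : ∀ a ∈ K, ¬ ∀ᶠ z in 𝓝 a, g z = g a) :
    {z ∈ K | deriv g z = 0}.Finite := by
  refine finite_setOf_eq_zero_of_isCompact hK hg.deriv fun a ha hderiv => h a ha ?_
  have horder := (hg a ha).analyticOrderAt_deriv_add_one
  rw [analyticOrderAt_eq_top.mpr hderiv, top_add] at horder
  simpa only [sub_eq_zero] using analyticOrderAt_eq_top.mp horder.symm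

end CriticalPoints

section Roots

variable {U : Set ℂ} {a : ℂ} {N : ℕ}

lemma exists_differentiableOn_pow_smul_eq {E : Type*} [NormedAddCommGroup E] [NormedSpace ℂ E]
    [CompleteSpace E] {G : ℂ → E} (hU : U ∈ 𝓝 a) (hG : DifferentiableOn ℂ G U)
    (hord : analyticOrderAt G a = N) :
    ∃ u : ℂ → E, DifferentiableOn ℂ u U ∧ u a ≠ 0 ∧ ∀ z, (z - a) ^ N • u z = G z := by
  induction N generalizing G with
  | zero =>
    refine ⟨G, hG, ?_, fun z => by simp⟩
    exact (hG.analyticAt hU).analyticOrderAt_eq_zero.mp (by simpa using hord)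
  | succ N ih =>
    have hGa : G a = 0 := apply_eq_zero_of_analyticOrderAt_ne_zero (by simp [hord])
    have hslope : DifferentiableOn ℂ (dslope G a) U := (Complex.differentiableOn_dslope hU).mpr hG
    have hfactor : (· - a) • dslope G a = G := funext fun z => sub_smul_dslope_of_zero hGa z
    have hslopeord : analyticOrderAt (dslope G a) a = N := by
      rw [← hfactor, analyticOrderAt_smul (by fun_prop) (hslope.analyticAt hU),
        analyticOrderAt_id_sub_const_self, add_comm, Nat.cast_succ] at hord
      exact (ENat.add_left_injective_of_ne_top ENat.one_ne_top) hord
    obtain ⟨u, hu, hua, hslopeu⟩ := ih hslope hslopeord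
    exact ⟨u, hu, hua, fun z => by
      rw [pow_succ', mul_smul, hslopeu, sub_smul_dslope_of_zero hGa]⟩

lemma exists_differentiableOn_pow_eq_of_ne_zero {u : ℂ → ℂ} (hU : IsOpen U)
    (hsc : IsSimplyConnected U) (hu : DifferentiableOn ℂ u U) (hu₀ : ∀ z ∈ U, u z ≠ 0)
    (hN : N ≠ 0) : ∃ v : ℂ → ℂ, DifferentiableOn ℂ v U ∧ ∀ z, v z ^ N = u z := by
  obtain ⟨v, hvc, hv⟩ := Complex.exists_continuousOn_pow_eq hsc hU hu.continuousOn
    (by rintro ⟨z, hz, h⟩; exact hu₀ z hz h) hN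
  refine ⟨v, fun z hz => ?_, hv⟩
  have hvz : v z ≠ 0 := ne_zero_pow hN (hv z ▸ hu₀ z hz)
  have hderiv := HasDerivAt.of_comp_left (hvc.continuousAt (hU.mem_nhds hz))
    (hasDerivAt_pow N (v z)) (hu.differentiableAt (hU.mem_nhds hz)).hasDerivAt
    (mul_ne_zero (Nat.cast_ne_zero.mpr hN) (pow_ne_zero _ hvz)) (.of_forall hv)
  exact hderiv.differentiableAt.differentiableWithinAt

lemma exists_differentiableOn_pow_eq_of_unique_zero {G : ℂ → ℂ} (hU : IsOpen U)
    (hsc : IsSimplyConnected U) (hG : DifferentiableOn ℂ G U) (ha : a ∈ U)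
    (hzero : ∀ z ∈ U, G z = 0 → z = a) (hord : analyticOrderAt G a = N) (hN : N ≠ 0) :
    ∃ φ : ℂ → ℂ, DifferentiableOn ℂ φ U ∧ ∀ z, φ z ^ N = G z := by
  obtain ⟨u, hu, hua, hGu⟩ := exists_differentiableOn_pow_smul_eq (hU.mem_nhds ha) hG hord
  have hu₀ : ∀ z ∈ U, u z ≠ 0 := fun z hz h =>
    hua (hzero z hz (by rw [← hGu, h, smul_zero]) ▸ h)
  obtain ⟨v, hv, hvu⟩ := exists_differentiableOn_pow_eq_of_ne_zero hU hsc hu hu₀ hN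
  exact ⟨fun z => (z - a) * v z, by fun_prop, fun z => by rw [mul_pow, hvu, ← smul_eq_mul, hGu]⟩

end Roots

section ProperMaps

open Polynomial

variable {g : ℂ → ℂ} {W' W : Set ℂ}

lemma isOpenMap_polynomial_eval {p : ℂ[X]} (hp : 0 < p.degree) : IsOpenMap p.eval := by
  refine (AnalyticOnNhd.eval_polynomial p).is_constant_or_isOpenMap.resolve_left ?_
  rintro ⟨w, hw⟩
  have hconst : p = C w := Polynomial.funext fun z => by rw [hw z, eval_C]
  exact hp.not_ge (hconst ▸ degree_C_le)

lemma surjOn_of_isProperMap_polynomial_eval_comp (hW' : IsOpen W') (hW : IsPreconnected W)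
    {p : ℂ[X]} (hp : 0 < p.degree) {φ : ℂ → ℂ} (hφ : DifferentiableOn ℂ φ W')
    (hφg : ∀ z ∈ W', p.eval (φ z) = g z) (hmaps : Set.MapsTo g W' W)
    (hprop : IsProperMap (hmaps.restrict g W' W)) {y : ℂ} (hy : y ∈ W)
    (hroots : ∀ s, p.eval s = y → s ∈ φ '' W') : Set.SurjOn φ W' (p.eval ⁻¹' W) := by
  have : PreconnectedSpace W := isPreconnected_iff_preconnectedSpace.mp hW
  have hφmaps : Set.MapsTo φ W' (p.eval ⁻¹' W) := fun z hz => by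
    simpa only [Set.mem_preimage, hφg z hz] using hmaps hz
  have hgan : AnalyticOnNhd ℂ g W' :=
    ((p.differentiable.comp_differentiableOn hφ).congr fun z hz => (hφg z hz).symm).analyticOnNhd
      hW'
  have hφopen : IsOpenMap (hφmaps.restrict φ W' _) :=
    isOpenMap_restrict_of_not_eventually_eq hW' (hφ.analyticOnNhd hW') (fun a ha hconst =>
      not_eventually_eq_of_isProperMap hW' hgan hmaps hprop ha <| by
        filter_upwards [hconst, hW'.mem_nhds ha] with z hz hzW
        rw [← hφg z hzW, hz, hφg a ha]) hφmaps
  have hpproper : IsProperMap (W.restrictPreimage p.eval) :=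
    (p.isProperMap_eval hp).restrictPreimage W
  have hcomp : W.restrictPreimage p.eval ∘ hφmaps.restrict φ W' _ = hmaps.restrict g W' W :=
    funext fun z => Subtype.ext (hφg z z.2)
  have hsurj := surjective_of_isProperMap_comp (hφ.continuousOn.mapsToRestrict hφmaps) hφopen
    hpproper.continuous ((isOpenMap_polynomial_eval hp).restrictPreimage W) hpproper.isClosedMap
    (hcomp ▸ hprop) (y := ⟨y, hy⟩) fun s hs => by
      obtain ⟨z, hz, hzs⟩ := hroots s (congrArg Subtype.val hs)
      exact ⟨⟨z, hz⟩, Subtype.ext hzs⟩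
  exact hφmaps.restrict_surjective_iff.mp hsurj

lemma connectedComponentIn_eq_of_unique_preimage (hW' : IsOpen W') (hW : IsPreconnected W)
    (hg : AnalyticOnNhd ℂ g W') (hmaps : Set.MapsTo g W' W)
    (hprop : IsProperMap (hmaps.restrict g W' W)) {c : ℂ} (hc : c ∈ W')
    (huniq : ∀ z ∈ W', g z = g c → z = c) : connectedComponentIn W' c = W' := by
  have : LocallyConnectedSpace W' := hW'.locallyConnectedSpace
  have : PreconnectedSpace W := isPreconnected_iff_preconnectedSpace.mp hW
  have hopen := isOpenMap_restrict_of_not_eventually_eq hW' hg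
    (fun a ha => not_eventually_eq_of_isProperMap hW' hg hmaps hprop ha) hmaps
  have hfibre : hmaps.restrict g W' W ⁻¹' {⟨g c, hmaps hc⟩} ⊆ connectedComponent ⟨c, hc⟩ :=
    fun z hz => by
      rw [show z = ⟨c, hc⟩ from Subtype.ext (huniq z z.2 (congrArg Subtype.val hz))]
      exact mem_connectedComponent
  rw [connectedComponentIn_eq_image hc, eq_univ_of_isClopen_of_preimage_singleton_subset hopen
    hprop.isClosedMap isClopen_connectedComponent hfibre, Set.image_univ, Subtype.range_coe]

theorem eq_of_totally_ramified {N : ℕ} (hN : 2 ≤ N) (hW' : IsOpen W')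
    (hsc : IsSimplyConnected W') (hW : IsPreconnected W) (hg : DifferentiableOn ℂ g W')
    (hmaps : Set.MapsTo g W' W) (hprop : IsProperMap (hmaps.restrict g W' W)) {a b : ℂ}
    (ha : a ∈ W') (hb : b ∈ W') (haram : ∀ z ∈ W', g z = g a → z = a)
    (hbram : ∀ z ∈ W', g z = g b → z = b) (hord : analyticOrderAt (fun w => g w - g a) a = N) :
    a = b := by
  have hN₀ : N ≠ 0 := by omega
  obtain ⟨φ, hφ, hφN⟩ := exists_differentiableOn_pow_eq_of_unique_zero hW' hsc
    (hg.sub_const (g a)) ha (fun z hz h => haram z hz (sub_eq_zero.mp h)) hord hN₀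
  set p : ℂ[X] := X ^ N + C (g a)
  have hφg : ∀ z, p.eval (φ z) = g z := fun z => by simp [p, hφN]
  have hφa : φ a = 0 := by simpa [hN₀] using hφN a
  have hsurj : Set.SurjOn φ W' (p.eval ⁻¹' W) :=
    surjOn_of_isProperMap_polynomial_eval_comp hW' hW
      (by rw [degree_X_pow_add_C hN₀.bot_lt]; exact_mod_cast hN₀.bot_lt) hφ (fun z _ => hφg z)
      hmaps hprop (hmaps ha) fun s hs => ⟨a, ha, by
        rw [hφa, eq_comm]
        simpa [p, hN₀] using hs⟩
  have hζ := Complex.isPrimitiveRoot_exp N hN₀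
  set ζ := Complex.exp (2 * Real.pi * Complex.I / N)
  have hζb : p.eval (ζ * φ b) = g b := by
    rw [← hφg b]
    simp [p, mul_pow, hζ.pow_eq_one]
  obtain ⟨z, hz, hzζ⟩ := hsurj (show p.eval (ζ * φ b) ∈ W from hζb ▸ hmaps hb)
  have hzb : z = b := hbram z hz (by rw [← hφg z, hzζ, hζb])
  have hφb : φ b = 0 := by
    by_contra hne
    exact hζ.ne_one hN (mul_right_cancel₀ hne (by rw [← hzζ, hzb, one_mul]))
  refine (haram b hb ?_).symm
  rw [← hφg b, ← hφg a, hφa, hφb]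

end ProperMaps

end ComplexAnalysis

section Degree

variable {W' Y : Set ℂ} {g : ℂ → ℂ} {N : ℕ} {a y : ℂ}

lemma HasDegreeOver.ncard_eq (h : HasDegreeOver g W' Y N) (hg : AnalyticOnNhd ℂ g W') (hy : y ∈ Y)
    (hcrit : ∀ z ∈ W', g z = y → deriv g z ≠ 0) : {z ∈ W' | g z = y}.ncard = N := by
  obtain ⟨hfin, hsum⟩ := h y hy
  rw [← hsum, finsum_mem_congr rfl (g := fun _ => 1), finsum_mem_eq_finite_toFinset_sum _ hfin,
    Finset.sum_const, smul_eq_mul, mul_one, Set.ncard_eq_toFinset_card _ hfin]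
  rintro z ⟨hz, rfl⟩
  rw [analyticOrderNatAt, (hg z hz).analyticOrderAt_sub_eq_one_of_deriv_ne_zero (hcrit z hz rfl),
    ENat.toNat_one]

lemma HasDegreeOver.not_eventually_eq (h : HasDegreeOver g W' Y N) (hW' : W' ∈ 𝓝 a)
    (ha : g a ∈ Y) : ¬ ∀ᶠ z in 𝓝 a, g z = g a := fun hconst =>
  infinite_of_mem_nhds a (inter_mem hW' hconst) (h (g a) ha).1

lemma HasDegreeOver.analyticOrderNatAt_eq (h : HasDegreeOver g W' Y N) (ha : a ∈ W')
    (haY : g a ∈ Y) (huniq : ∀ z ∈ W', g z = g a → z = a) :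
    analyticOrderNatAt (fun w => g w - g a) a = N := by
  have hfibre : {z ∈ W' | g z = g a} = {a} := Set.Subset.antisymm
    (fun z hz => huniq z hz.1 hz.2) (Set.singleton_subset_iff.mpr ⟨ha, rfl⟩)
  rw [← (h (g a) haY).2, hfibre, finsum_mem_singleton]

end Degree

section InvariantSets

section Derivatives

variable {𝕜 : Type*} [NontriviallyNormedField 𝕜]

lemma differentiableAt_iterate {E : Type*} [NormedAddCommGroup E] [NormedSpace 𝕜 E] {g : E → E}
    {X : Set E} (hmaps : Set.MapsTo g X X) (hg : ∀ x ∈ X, DifferentiableAt 𝕜 g x) (n : ℕ) :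
    ∀ x ∈ X, DifferentiableAt 𝕜 g^[n] x := by
  induction n with
  | zero => exact fun x _ => differentiableAt_id
  | succ n ih => exact fun x hx => (ih (g x) (hmaps hx)).comp x (hg x hx)

lemma hasDerivAt_iterate_zero {g : 𝕜 → 𝕜} {X : Set 𝕜} (hmaps : Set.MapsTo g X X)
    (hg : ∀ x ∈ X, DifferentiableAt 𝕜 g x) {c : 𝕜} (hc : c ∈ X) (hderiv : deriv g c = 0) {p : ℕ}
    (hp : 0 < p) : HasDerivAt g^[p] 0 c := by
  obtain ⟨p, rfl⟩ := Nat.exists_eq_add_one_of_ne_zero hp.ne'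
  have hcomp :=
    (differentiableAt_iterate hmaps hg p (g c) (hmaps hc)).hasDerivAt.comp c (hg c hc).hasDerivAt
  rw [hderiv, mul_zero] at hcomp
  exact hcomp

lemma eventually_dist_le_mul_of_hasDerivAt_zero {E : Type*} [NormedAddCommGroup E]
    [NormedSpace 𝕜 E] {g : 𝕜 → E} {c : 𝕜} (h : HasDerivAt g 0 c) {ε : ℝ} (hε : 0 < ε) :
    ∀ᶠ z in 𝓝 c, dist (g z) (g c) ≤ ε * dist z c := by
  simpa only [smul_zero, sub_zero, ← dist_eq_norm] using (hasDerivAt_iff_isLittleO.mp h).def hε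

lemma exists_nhds_injOn_of_deriv_ne_zero [CompleteSpace 𝕜] {g : 𝕜 → 𝕜} {z : 𝕜}
    (hg : AnalyticAt 𝕜 g z) (hz : deriv g z ≠ 0) : ∃ U ∈ 𝓝 z, Set.InjOn g U :=
  ⟨_, hg.hasStrictDerivAt.eventually_left_inverse hz,
    fun _ ha _ hb hab => ha.symm.trans <| (congrArg _ hab).trans hb⟩

variable {X : Set 𝕜} {f : X → X} {g : 𝕜 → 𝕜}

lemma eventually_iterate_ne_of_deriv_eq_zero (hg : ∀ x ∈ X, DifferentiableAt 𝕜 g x)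
    (hf : Continuous f) (hext : ∀ x : X, g x = f x) {c x : X} (hderiv : deriv g c = 0)
    (hc : c ∈ Function.periodicPts f) (hx : ∀ k, f^[k] c ≠ x) :
    ∀ᶠ q : ℕ × X in atTop ×ˢ 𝓝 c, f^[q.1] q.2 ≠ x := by
  obtain ⟨p, hp, hpc⟩ := hc
  have hmaps : Set.MapsTo g X X := fun x hx => hext ⟨x, hx⟩ ▸ (f ⟨x, hx⟩).2
  have hsemi : Function.Semiconj Subtype.val f g := fun x => (hext x).symm
  have hcontr : ∀ᶠ z in 𝓝 c, dist (f^[p] z) c ≤ 2⁻¹ * dist z c := by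
    filter_upwards [continuous_subtype_val.continuousAt.eventually <|
      eventually_dist_le_mul_of_hasDerivAt_zero (hasDerivAt_iterate_zero hmaps hg c.2 hderiv hp)
        (inv_pos.mpr two_pos)] with z hz
    rwa [← hsemi.iterate_right p, ← hsemi.iterate_right p, hpc.eq] at hz
  exact eventually_iterate_ne_of_tendsto hf hp
    (tendsto_iterate_of_dist_le_mul (by positivity) (by norm_num) hcontr) hx

end Derivatives

variable {X W' : Set ℂ} {f : X → X} {g : ℂ → ℂ} {N : ℕ}

lemma image_val_preimage_singleton (hext : ∀ x : X, g x = f x)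
    (hpre : {z ∈ W' | g z ∈ X} = X) (y : X) :
    Subtype.val '' (f ⁻¹' {y}) = {z ∈ W' | g z = y} := by
  ext z
  constructor
  · rintro ⟨z, rfl, rfl⟩
    exact ⟨(hpre.symm.subset z.2).1, hext z⟩
  · rintro ⟨hz, hzy⟩
    have hzX : z ∈ X := hpre ▸ ⟨hz, hzy ▸ y.2⟩
    exact ⟨⟨z, hzX⟩, Subtype.ext ((hext _).symm.trans hzy), rfl⟩

lemma exists_entourage_hasSeparatedPreimages (hX : IsCompact X) (hg : AnalyticOnNhd ℂ g W')
    (hext : ∀ x : X, g x = f x) (hpre : {z ∈ W' | g z ∈ X} = X) (hdeg : HasDegreeOver g W' X N)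
    {U : Set X} (hU : U ∈ 𝓝ˢ {c : X | deriv g c = 0}) :
    ∃ V ∈ 𝓤 X, ∀ y, (∃ w ∈ U, f w = y) ∨ HasSeparatedPreimages f V N y := by
  have : CompactSpace X := isCompact_iff_compactSpace.mp hX
  have hXW' : X ⊆ W' := hpre.symm.subset.trans (Set.sep_subset W' _)
  have hlocal : ∀ z ∈ (interior U)ᶜ, ∃ T ∈ 𝓝 z, Set.InjOn f T := fun z hz => by
    obtain ⟨T, hT, hinj⟩ := exists_nhds_injOn_of_deriv_ne_zero (hg z (hXW' z.2))
      fun hderiv => hz (subset_interior_iff_mem_nhdsSet.mpr hU hderiv)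
    exact ⟨_, continuous_subtype_val.continuousAt hT, fun a ha b hb hab =>
      Subtype.ext (hinj ha hb (by rw [hext, hext, hab]))⟩
  obtain ⟨V, hV, hinj⟩ :=
    exists_entourage_injOn_ball isOpen_interior.isClosed_compl.isCompact hlocal
  refine ⟨V, hV, fun y => or_iff_not_imp_left.mpr fun hy => ?_⟩
  have hfibre := image_val_preimage_singleton hext hpre y
  have hfin : (f ⁻¹' {y}).Finite :=
    .of_finite_image (hfibre ▸ (hdeg y y.2).1) Subtype.val_injective.injOn
  have hcrit : ∀ z ∈ W', g z = y → deriv g z ≠ 0 := fun z hz hzy hderiv => by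
    obtain ⟨w, hwy, rfl⟩ := hfibre.symm.subset ⟨hz, hzy⟩
    exact hy ⟨w, subset_of_mem_nhdsSet hU hderiv, hwy⟩
  have hcard : (f ⁻¹' {y}).ncard = N := by
    rw [← Set.ncard_image_of_injective _ Subtype.val_injective, hfibre,
      hdeg.ncard_eq hg y.2 hcrit]
  refine ⟨hfin.toFinset, by rw [← Set.ncard_eq_toFinset_card _ hfin, hcard], by simp, ?_⟩
  rw [hfin.coe_toFinset]
  intro z hz z' hz' hne hzz'
  exact hne (hinj z (fun hzU => hy ⟨z, interior_subset hzU, hz⟩) (refl_mem_uniformity hV) hzz'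
    (hz.trans hz'.symm))

theorem log_le_coverEntropy_of_unionOfCriticalCycles_ne_univ (hX : IsCompact X)
    (hW' : IsOpen W') (hg : DifferentiableOn ℂ g W') (hext : ∀ x : X, g x = f x)
    (hpre : {z ∈ W' | g z ∈ X} = X) (hN : N ≠ 0) (hdeg : HasDegreeOver g W' X N)
    (hne : unionOfCriticalCycles f g ≠ Set.univ) :
    (Real.log N : EReal) ≤ coverEntropy f Set.univ := by
  have hXW' : X ⊆ W' := hpre.symm.subset.trans (Set.sep_subset W' _)
  have hgX : ∀ x ∈ X, g x ∈ X := fun x hx => hext ⟨x, hx⟩ ▸ (f ⟨x, hx⟩).2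
  have hgW' := hg.analyticOnNhd hW'
  have hf : Continuous f := continuous_induced_rng.mpr <|
    (continuousOn_iff_continuous_domRestrict.mp (hg.continuousOn.mono hXW')).congr hext
  have hcrit : {c : X | deriv g c = 0}.Finite := by
    have hfin := finite_setOf_deriv_eq_zero_of_isCompact hX (hgW'.mono hXW') fun a ha =>
      hdeg.not_eventually_eq (hW'.mem_nhds (hXW' ha)) (hgX a ha)
    exact (hfin.preimage Subtype.val_injective.injOn).subset fun c hc => ⟨c.2, hc⟩
  obtain ⟨x, hx⟩ := (Set.ne_univ_iff_exists_notMem _).mp hne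
  refine log_le_coverEntropy_of_backwardVisitFrequencyLE hN x fun ε hε => ?_
  obtain ⟨U, hU, hUx⟩ := exists_nhdsSet_backwardVisitFrequencyLE hf hcrit (fun c hc hper =>
    eventually_iterate_ne_of_deriv_eq_zero (fun z hz => (hgW' z (hXW' hz)).differentiableAt) hf
      hext hc hper fun k hk => hx ⟨c, hc, hper, k, hk⟩) hε
  exact ⟨U, hUx, exists_entourage_hasSeparatedPreimages hX hgW' hext hpre hdeg hU⟩

lemma injective_of_unionOfCriticalCycles_eq_univ (h : unionOfCriticalCycles f g = Set.univ) :
    Function.Injective f := by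
  have hper : Function.periodicPts f = Set.univ := Set.eq_univ_of_forall fun x => by
    obtain ⟨c, -, ⟨p, hp, hc⟩, k, rfl⟩ := h ▸ Set.mem_univ x
    exact ⟨p, hp, hc.apply_iterate k⟩
  exact Set.injOn_univ.mp (hper ▸ (Function.bijOn_periodicPts f).injOn)

theorem exists_eq_singleton_of_injective {W : Set ℂ} (hXne : X.Nonempty) (hW' : IsOpen W')
    (hW : IsPreconnected W) (hg : DifferentiableOn ℂ g W') (hmaps : Set.MapsTo g W' W)
    (hprop : IsProperMap (hmaps.restrict g W' W)) (hext : ∀ x : X, g x = f x)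
    (hpre : {z ∈ W' | g z ∈ X} = X) (hN : 2 ≤ N) (hdeg : HasDegreeOver g W' X N)
    (hsc : ∀ x ∈ X, IsSimplyConnected (connectedComponentIn W' x)) (hinj : Function.Injective f) :
    IsConnected W' ∧ IsSimplyConnected W' ∧ ∃ c : ℂ, X = {c} ∧ g c = c ∧ deriv g c = 0 ∧
      analyticOrderNatAt (fun w => g w - g c) c = N := by
  have hXW' : X ⊆ W' := hpre.symm.subset.trans (Set.sep_subset W' _)
  have hgX : ∀ x ∈ X, g x ∈ X := fun x hx => hext ⟨x, hx⟩ ▸ (f ⟨x, hx⟩).2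
  have huniq : ∀ x ∈ X, ∀ z ∈ W', g z = g x → z = x := fun x hx z hz hzx => by
    have hzX : z ∈ X := hpre ▸ ⟨hz, hzx ▸ hgX x hx⟩
    exact congrArg Subtype.val (@hinj ⟨z, hzX⟩ ⟨x, hx⟩ (Subtype.ext (by rwa [← hext, ← hext])))
  obtain ⟨c, hc⟩ := hXne
  have hcW' := hXW' hc
  have hscW' : IsSimplyConnected W' := connectedComponentIn_eq_of_unique_preimage hW' hW
    (hg.analyticOnNhd hW') hmaps hprop hcW' (huniq c hc) ▸ hsc c hc
  have hordNat := hdeg.analyticOrderNatAt_eq hcW' (hgX c hc) (huniq c hc)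
  have hord : analyticOrderAt (fun w => g w - g c) c = N := by
    refine hordNat ▸ (Nat.cast_analyticOrderNatAt fun htop => ?_).symm
    rw [analyticOrderNatAt, htop, ENat.toNat_top] at hordNat
    omega
  have hXc : ∀ x ∈ X, x = c := fun x hx => (eq_of_totally_ramified hN hW' hscW' hW hg hmaps
    hprop hcW' (hXW' hx) (huniq c hc) (huniq x hx) hord).symm
  have hderiv : deriv g c = 0 := by
    by_contra hne
    rw [(hg.analyticAt (hW'.mem_nhds hcW')).analyticOrderAt_sub_eq_one_of_deriv_ne_zero hne] at hord
    exact absurd (Nat.cast_eq_one.mp hord.symm) (by omega)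
  exact ⟨hscW'.isPathConnected.isConnected, hscW', c, Set.eq_singleton_iff_unique_mem.mpr ⟨hc, hXc⟩,
    hXc _ (hgX c hc), hderiv, hordNat⟩

end InvariantSets

theorem theoremA1_general (X : Set ℂ) (hX : IsCompact X) (hXne : X.Nonempty)
    (f : X → X) (W' W : Set ℂ) (hW' : IsOpen W')
    (g : ℂ → ℂ) (hg : DifferentiableOn ℂ g W') (hmaps : Set.MapsTo g W' W)
    (hext : ∀ x : X, g (x : ℂ) = (f x : ℂ))
    (hpre : {z ∈ W' | g z ∈ X} = X)
    (N : ℕ) (hN : 2 ≤ N) (hdeg : HasDegreeOver g W' X N) :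
    (unionOfCriticalCycles f g ≠ Set.univ →
      ((Real.log N : ℝ) : EReal) ≤ Dynamics.coverEntropy f Set.univ) ∧
    (IsProperMap (hmaps.restrict g W' W) → IsPreconnected W →
      (∀ x ∈ X, IsSimplyConnected (connectedComponentIn W' x)) →
      ((Real.log N : ℝ) : EReal) ≤ Dynamics.coverEntropy f Set.univ ∨
        (IsConnected W' ∧ IsSimplyConnected W' ∧
          ∃ c : ℂ, X = {c} ∧ g c = c ∧ deriv g c = 0 ∧
            analyticOrderNatAt (fun w => g w - g c) c = N)) := by
  have hentropy := log_le_coverEntropy_of_unionOfCriticalCycles_ne_univ hX hW' hg hext hpre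
    (by omega) hdeg
  refine ⟨hentropy, fun hprop hW hsc => ?_⟩
  by_cases hcycles : unionOfCriticalCycles f g = Set.univ
  · exact .inr <| exists_eq_singleton_of_injective hXne hW' hW hg hmaps hprop hext hpre hN hdeg hsc
      (injective_of_unionOfCriticalCycles_eq_univ hcycles)
  · exact .inl (hentropy hcycles)

theorem theoremA1 (X : Set ℂ) (hX : IsCompact X) (hXne : X.Nonempty)
    (f : X → X) (hf : Continuous f)
    (W' W : Set ℂ) (hW' : IsOpen W') (hW : IsOpen W) (hXW' : X ⊆ W') (hXW : X ⊆ W)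
    (g : ℂ → ℂ) (hg : DifferentiableOn ℂ g W') (hmaps : Set.MapsTo g W' W)
    (hext : ∀ x : X, g (x : ℂ) = (f x : ℂ))
    (hpre : {z ∈ W' | g z ∈ X} = X)
    (N : ℕ) (hN : 2 ≤ N) (hdeg : HasDegreeOver g W' X N) :
    (unionOfCriticalCycles f g ≠ Set.univ →
      ((Real.log N : ℝ) : EReal) ≤ Dynamics.coverEntropy f Set.univ) ∧
    (IsProperMap (hmaps.restrict g W' W) → HasDegreeOver g W' W N →
      IsSimplyConnected W → HasFinitelyManySimplyConnectedComponents W' →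
      ((Real.log N : ℝ) : EReal) ≤ Dynamics.coverEntropy f Set.univ ∨
        (IsConnected W' ∧ IsSimplyConnected W' ∧
          ∃ c : ℂ, X = {c} ∧ g c = c ∧ deriv g c = 0 ∧
            analyticOrderNatAt (fun w => g w - g c) c = N)) := by
  have h := theoremA1_general X hX hXne f W' W hW' g hg hmaps hext hpre N hN hdeg
  exact ⟨h.1, fun hprop _ hscW hcomp => h.2 hprop hscW.isPathConnected.isConnected.isPreconnected
    fun x hx => hcomp.2 x (hXW' hx)⟩
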